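/- Let $G$ be a finite simple graph with vertex set $V$ and shortest-path distance $d$, where $d(a,b)=\infty$ if $a$ and $b$ lie in different connected components. For integers $k,\ell\ge 0$ let $EMC_{k,\ell}(G)$ be the free abelian group on all tuples $(v_0,\dots,v_k)\in V^{k+1}$ of pairwise distinct vertices such that $d(v_i,v_{i+1})<\infty$ for $0\le i<k$ and $\sum_{i=0}^{k-1}d(v_i,v_{i+1})=\ell$. Let $\partial_{k,\ell}\colon EMC_{k,\ell}(G)\to EMC_{k-1,\ell}(G)$ be the homomorphism $$\partial_{k,\ell}(v_0,\dots,v_k)=\sum_{i=1}^{k-1}(-1)^i\,\partial^i_{k,\ell}(v_0,\dots,v_k),$$ where $\partial^i_{k,\ell}(v_0,\dots,v_k)$ is the tuple obtained by removing $v_i$ if that tuple still has length $\ell$, and $0$ otherwise (and $\partial_{0,\ell}=0$). Then $\partial_{k,\ell}\circ\partial_{k+1,\ell}=0$, and the Eulerian magnitude homology of $G$ is $EMH_{k,\ell}(G)=\ker\partial_{k,\ell}/\operatorname{im}\partial_{k+1,\ell}$. Theorem. For every finitely generated abelian group $A$ (equivalently, every group $A=\mathbb{Z}^r\oplus\mathbb{Z}_{p_1^{r_1}}\oplus\cdots\oplus\mathbb{Z}_{p_n^{r_n}}$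 with $p_i$ prime) there exist a finite graph $G$ and positive integers $k,\ell$ such that $A$ is isomorphic to a subgroup of $EMH_{k,\ell}(G)$. -/

import Mathlib

/-!
# Eulerian magnitude homology of a graph

Tuples of `k + 1` vertices are functions `Fin (k + 1) → V`; the distance of a graph is Mathlib's
`SimpleGraph.edist`, with value `⊤` between vertices in different components.
-/

namespace EulerianMagnitude

variable {V : Type*} (G : SimpleGraph V)

/-- A `k`-path: consecutive vertices are distinct and at finite distance. -/
def IsKPath {k : ℕ} (v : Fin (k + 1) → V) : Prop :=
  ∀ i : Fin k, v i.castSucc ≠ v i.succ ∧ G.edist (v i.castSucc) (v i.succ) < ⊤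

/-- The length of a tuple: the sum of the distances of consecutive vertices. -/
noncomputable def len {k : ℕ} (v : Fin (k + 1) → V) : ℕ∞ :=
  ∑ i : Fin k, G.edist (v i.castSucc) (v i.succ)

/-- An Eulerian `k`-path: a `k`-path without repeated vertices. -/
def IsEulerianPath {k : ℕ} (v : Fin (k + 1) → V) : Prop :=
  IsKPath G v ∧ Function.Injective v

/-- The Eulerian `k`-paths of length `ℓ`. -/
abbrev EulerianPath (k ℓ : ℕ) : Type _ :=
  {v : Fin (k + 1) → V // IsEulerianPath G v ∧ len G v = ℓ}

/-- The Eulerian magnitude chain group: the free abelian group on the Eulerian `k`-paths of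
length `ℓ`. -/
abbrev EMC (k ℓ : ℕ) : Type _ := EulerianPath G k ℓ →₀ ℤ

/-- For a tuple `(v_0, …, v_{k+1})` and `i ∈ {0, …, k-1}`, remove the interior vertex
`v_{i+1}`. -/
def face {k : ℕ} (i : Fin k) (v : Fin (k + 2) → V) : Fin (k + 1) → V :=
  i.castSucc.succ.removeNth v

variable {G}

theorem len_succ {k : ℕ} (v : Fin (k + 2) → V) :
    len G v = G.edist (v 0) (v 1) + len G (Fin.tail v) := by
  simp [len, Fin.sum_univ_succ, Fin.tail]

theorem len_face_le {k : ℕ} (i : Fin k) (v : Fin (k + 2) → V) :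
    len G (face i v) ≤ len G v := by
  induction k with
  | zero => exact i.elim0
  | succ k ih =>
    rw [len_succ, len_succ v]
    refine Fin.cases ?_ (fun j => ?_) i
    · rw [len_succ (Fin.tail v), ← add_assoc]
      exact add_le_add G.edist_triangle le_rfl
    · have h0 : face j.succ v 0 = v 0 := rfl
      have h1 : face j.succ v 1 = v 1 := by
        simp [face, Fin.removeNth, Fin.succAbove, Fin.lt_def]
      have h2 : Fin.tail (face j.succ v) = face j (Fin.tail v) := by
        funext x
        simp [face, Fin.removeNth, Fin.tail]
      rw [h0, h1, h2]
      gcongr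
      exact ih j _

theorem IsEulerianPath.edist_lt_top {k : ℕ} {v : Fin (k + 1) → V} (hv : IsEulerianPath G v)
    (a b : Fin (k + 1)) : G.edist (v a) (v b) < ⊤ := by
  have h0 : ∀ a, G.edist (v 0) (v a) < ⊤ := by
    intro a
    induction a using Fin.induction with
    | zero => simp
    | succ i ih => exact lt_of_le_of_lt G.edist_triangle (WithTop.add_lt_top.2 ⟨ih, (hv.1 i).2⟩)
  exact lt_of_le_of_lt G.edist_triangle
    (WithTop.add_lt_top.2 ⟨(G.edist_comm (u := v a) (v := v 0)).symm ▸ h0 a, h0 b⟩)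

theorem IsEulerianPath.face {k : ℕ} {v : Fin (k + 2) → V} (hv : IsEulerianPath G v)
    (i : Fin k) : IsEulerianPath G (face i v) := by
  have hinj : Function.Injective (EulerianMagnitude.face i v) :=
    hv.2.comp Fin.succAbove_right_injective
  refine ⟨fun j => ⟨fun h => ?_, hv.edist_lt_top _ _⟩, hinj⟩
  have := congrArg Fin.val (hinj h)
  simp at this

variable (G)

open Classical in
/-- The `i`-th face of a generator: the path with the interior vertex `v_{i+1}` removed if this
still has length `ℓ`, and `0` otherwise. -/
noncomputable def faceChain {k ℓ : ℕ} (i : Fin k) (v : EulerianPath G (k + 1) ℓ) : EMC G k ℓ :=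
  if h : len G (face i v.1) = ℓ then Finsupp.single ⟨face i v.1, v.2.1.face i, h⟩ 1 else 0

/-- The boundary map from degree `k + 1` to degree `k`: the alternating sum over the interior
vertices `v_1, …, v_k` of `(v_0, …, v_{k+1})`. -/
noncomputable def boundary (k ℓ : ℕ) : EMC G (k + 1) ℓ →ₗ[ℤ] EMC G k ℓ :=
  Finsupp.lift (EMC G k ℓ) ℤ (EulerianPath G (k + 1) ℓ)
    (fun v => ∑ i : Fin k, (-1 : ℤ) ^ ((i : ℕ) + 1) • faceChain G i v)

variable {G}

theorem boundary_single {k ℓ : ℕ} (v : EulerianPath G (k + 1) ℓ) :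
    boundary G k ℓ (Finsupp.single v 1) =
      ∑ i : Fin k, (-1 : ℤ) ^ ((i : ℕ) + 1) • faceChain G i v := by
  simp [boundary]

/-- Simplicial identity for interior faces. -/
theorem face_face {k : ℕ} (i : Fin (k + 1)) (j : Fin k) (h : (j : ℕ) < i)
    (v : Fin (k + 3) → V) :
    face j (face i v) = face (⟨i - 1, by omega⟩ : Fin k) (face j.castSucc v) := by
  funext x
  simp only [face, Fin.removeNth]
  congr 1
  ext
  simp only [Fin.succAbove, Fin.lt_def]
  split_ifs <;> simp_all <;> omega

open Classical in
theorem boundary_boundary_single {k ℓ : ℕ} (v : EulerianPath G (k + 2) ℓ) :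
    boundary G k ℓ (boundary G (k + 1) ℓ (Finsupp.single v 1)) = 0 := by
  let T : (Fin (k + 1) → V) → EMC G k ℓ := fun w =>
    if h : IsEulerianPath G w ∧ len G w = ℓ then Finsupp.single ⟨w, h⟩ 1 else 0
  have key : ∀ i : Fin (k + 1), boundary G k ℓ (faceChain G i v) =
      ∑ j : Fin k, (-1 : ℤ) ^ ((j : ℕ) + 1) • T (face j (face i v.1)) := by
    intro i
    have hE := v.2.1.face i
    by_cases h : len G (face i v.1) = ℓ
    · rw [faceChain, dif_pos h, boundary_single]
      refine Finset.sum_congr rfl fun j _ => ?_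
      congr 1
      by_cases h' : len G (face j (face i v.1)) = ℓ
      · simp only [T]
        rw [faceChain, dif_pos h', dif_pos ⟨hE.face j, h'⟩]
      · simp only [T]
        rw [faceChain, dif_neg h', dif_neg fun h'' => h' h''.2]
    · rw [faceChain, dif_neg h, map_zero]
      symm
      refine Finset.sum_eq_zero fun j _ => ?_
      have hlt : len G (face i v.1) < ℓ :=
        lt_of_le_of_ne ((len_face_le i v.1).trans_eq v.2.2) h
      simp only [T]
      rw [dif_neg fun h'' => (lt_of_le_of_lt (len_face_le j _) hlt).ne h''.2, smul_zero]
  rw [boundary_single, map_sum]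
  simp only [map_smul, key, Finset.smul_sum, smul_smul, ← pow_add]
  rw [← Finset.sum_product', Finset.univ_product_univ]
  refine Finset.sum_involution
    (fun p _ => if h : (p.2 : ℕ) < p.1 then (p.2.castSucc, ⟨p.1 - 1, by omega⟩)
      else (p.2.succ, ⟨p.1, by omega⟩)) ?_ ?_ ?_ ?_
  · rintro ⟨i, j⟩ -
    by_cases h : (j : ℕ) < i
    · simp only [h, dif_pos]
      rw [face_face i j h, ← add_smul]
      have e : (i : ℕ) + 1 + (j + 1) = ((j.castSucc : Fin (k + 1)) : ℕ) + 1 + (i - 1 + 1) + 1 := by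
        simp; omega
      rw [e, pow_succ]
      simp
    · simp only [h, dif_neg, not_false_iff]
      rw [face_face j.succ ⟨i, by omega⟩ (by simp; omega)]
      have e1 : (⟨(j.succ : Fin (k + 1)) - 1, by simp⟩ : Fin k) = j := by ext; simp
      have e2 : (⟨i, by omega⟩ : Fin k).castSucc = i := by ext; simp
      rw [e1, e2, ← add_smul]
      have e : ((j.succ : Fin (k + 1)) : ℕ) + 1 + (i + 1) = (i : ℕ) + 1 + (j + 1) + 1 := by
        simp; omega
      simp only [e]
      rw [pow_succ]
      simp
  · rintro ⟨i, j⟩ - -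
    by_cases h : (j : ℕ) < i
    · simp only [h, dif_pos, ne_eq, Prod.mk.injEq, Fin.ext_iff]
      simp; omega
    · simp only [h, dif_neg, not_false_iff, ne_eq, Prod.mk.injEq, Fin.ext_iff]
      simp; omega
  · intros; simp
  · rintro ⟨i, j⟩ -
    by_cases h : (j : ℕ) < i
    · have : ¬ ((i : ℕ) - 1 < j) := by omega
      simp [h, this, Fin.ext_iff]
      omega
    · have : (i : ℕ) < j + 1 := by omega
      simp [h, this, Fin.ext_iff]

theorem boundary_comp_boundary (k ℓ : ℕ) :
    boundary G k ℓ ∘ₗ boundary G (k + 1) ℓ = 0 := by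
  refine Finsupp.lhom_ext' fun v => LinearMap.ext_ring ?_
  simpa using boundary_boundary_single v

variable (G)

/-- The cycles: the kernel of the boundary map out of degree `k`, which is zero for `k = 0`. -/
noncomputable def cycles : (k ℓ : ℕ) → Submodule ℤ (EMC G k ℓ)
  | 0, _ => ⊤
  | k + 1, ℓ => LinearMap.ker (boundary G k ℓ)

theorem boundary_mem_cycles (k ℓ : ℕ) (c : EMC G (k + 1) ℓ) :
    boundary G k ℓ c ∈ cycles G k ℓ := by
  cases k with
  | zero => trivial
  | succ k => exact LinearMap.congr_fun (boundary_comp_boundary k ℓ) c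

/-- The Eulerian magnitude homology group: the kernel of the boundary map out of degree `k` modulo
the image of the boundary map out of degree `k + 1`. -/
abbrev EMH (k ℓ : ℕ) : Type _ :=
  cycles G k ℓ ⧸ LinearMap.range ((boundary G k ℓ).codRestrict (cycles G k ℓ)
    (boundary_mem_cycles G k ℓ))

end EulerianMagnitude

/-!
In the Hasse diagram of an `ℕ`-graded poset, the distance of two elements is at least the difference
of their grades, and an element `x` lies below `y` exactly if `grade x + d(x, y) = grade y`. Hence
the Eulerian paths of length `grade b - grade a` from `a` to `b` are the strict chains from `a` to
`b`, and they span a summand of the magnitude complex which computes the homology of the order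
complex of the open interval `(a, b)`. It therefore suffices to find a finite complex of dimension
two whose first homology contains `A`, and to take its face poset.

Let `A = ℤⁿ × T` with `T` finite, and let `I` consist of the basis of `ℤⁿ` and of the elements of
`T`. Replace every side of a triangle by parallel edges labelled by `I`, and for every relation
`s + t = u` in `I` glue in a triangle with sides labelled `s`, `t` and `u`; this is a finite piece
of the quotient of the Milnor join `A * A * A` by `A`. The loop which runs along the edge `s` and
back along the edge `0` has a homology class which is additive in `s`, so these classes define a
homomorphism on `A`. It has a left inverse given by the cocycle which reads off the labels.
-/

namespace EulerianMagnitude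

open SimpleGraph

section TupleChain

variable {V : Type*} (G : SimpleGraph V) {k ℓ : ℕ}

theorem face_zero_cons (a x : V) (v : Fin (k + 1) → V) :
    face 0 (Matrix.vecCons a (Matrix.vecCons x v)) = Matrix.vecCons a v := by
  funext i
  cases i using Fin.cases <;> rfl

theorem face_succ_cons (i : Fin k) (a : V) (v : Fin (k + 2) → V) :
    face i.succ (Matrix.vecCons a v) = Matrix.vecCons a (face i v) := by
  funext j
  cases j using Fin.cases with
  | zero => rfl
  | succ j => simp [face, Fin.removeNth]

open Classical in
/-- The generator of `EMC G k ℓ` given by a tuple, extended by `0` to the tuples that are not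
Eulerian paths of length `ℓ`. -/
noncomputable def tupleChain (ℓ : ℕ) (v : Fin (k + 1) → V) : EMC G k ℓ :=
  if h : IsEulerianPath G v ∧ len G v = ℓ then Finsupp.single ⟨v, h⟩ 1 else 0

variable {G}

theorem tupleChain_coe (v : EulerianPath G k ℓ) : tupleChain G ℓ v.1 = Finsupp.single v 1 :=
  dif_pos v.2

theorem faceChain_eq_tupleChain (i : Fin k) (v : EulerianPath G (k + 1) ℓ) :
    faceChain G i v = tupleChain G ℓ (face i v.1) := by
  simp only [faceChain, tupleChain, v.2.1.face i, true_and]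

theorem boundary_tupleChain {v : Fin (k + 2) → V} (hv : IsEulerianPath G v ∧ len G v = ℓ) :
    boundary G k ℓ (tupleChain G ℓ v) =
      ∑ i : Fin k, (-1 : ℤ) ^ ((i : ℕ) + 1) • tupleChain G ℓ (face i v) := by
  simp only [tupleChain_coe ⟨v, hv⟩, boundary_single, faceChain_eq_tupleChain]

theorem boundary_tupleChain_four {a x y b : V}
    (h : IsEulerianPath G ![a, x, y, b] ∧ len G ![a, x, y, b] = ℓ) :
    boundary G 2 ℓ (tupleChain G ℓ ![a, x, y, b]) =
      tupleChain G ℓ ![a, x, b] - tupleChain G ℓ ![a, y, b] := by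
  rw [boundary_tupleChain h]
  simp only [Fin.sum_univ_succ, face_zero_cons, face_succ_cons, Fin.val_zero, Fin.val_succ,
    Finset.univ_eq_empty, Finset.sum_empty]
  module

theorem boundary_tupleChain_five {a x y z b : V}
    (h : IsEulerianPath G ![a, x, y, z, b] ∧ len G ![a, x, y, z, b] = ℓ) :
    boundary G 3 ℓ (tupleChain G ℓ ![a, x, y, z, b]) =
      tupleChain G ℓ ![a, x, z, b] - tupleChain G ℓ ![a, x, y, b] -
        tupleChain G ℓ ![a, y, z, b] := by
  rw [boundary_tupleChain h]
  simp only [Fin.sum_univ_succ, face_zero_cons, face_succ_cons, Fin.val_zero, Fin.val_succ,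
    Finset.univ_eq_empty, Finset.sum_empty]
  module

end TupleChain

section Homology

variable {V A : Type*} {G : SimpleGraph V} [AddCommGroup A] {k ℓ : ℕ}

/-- The homology class of a cycle. -/
noncomputable def homologyClass : cycles G k ℓ →ₗ[ℤ] EMH G k ℓ := Submodule.mkQ _

/-- The class of a chain modulo boundaries. Homology embeds into the quotient of all chains by the
boundaries, where relations between classes of chains that are not cycles can be used. -/
noncomputable def chainClass : EMC G k ℓ →ₗ[ℤ] EMC G k ℓ ⧸ LinearMap.range (boundary G k ℓ) :=
  Submodule.mkQ _

theorem chainClass_boundary (c : EMC G (k + 1) ℓ) : chainClass (boundary G k ℓ c) = 0 :=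
  (Submodule.Quotient.mk_eq_zero _).2 ⟨c, rfl⟩

theorem homologyClass_eq_iff {z w : cycles G k ℓ} :
    homologyClass z = homologyClass w ↔
      chainClass (z : EMC G k ℓ) = chainClass (w : EMC G k ℓ) := by
  simp only [homologyClass, chainClass, Submodule.mkQ_apply, Submodule.Quotient.eq,
    LinearMap.mem_range, Subtype.ext_iff, LinearMap.codRestrict_apply, AddSubgroupClass.coe_sub]

/-- The map induced on homology by a cocycle `φ`. -/
noncomputable def homologyLift (φ : EMC G k ℓ →ₗ[ℤ] A) (hφ : φ ∘ₗ boundary G k ℓ = 0) :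
    EMH G k ℓ →ₗ[ℤ] A :=
  Submodule.liftQ _ (φ ∘ₗ (cycles G k ℓ).subtype) <| by
    rintro _ ⟨c, rfl⟩
    exact LinearMap.congr_fun hφ c

theorem homologyLift_homologyClass (φ : EMC G k ℓ →ₗ[ℤ] A) (hφ : φ ∘ₗ boundary G k ℓ = 0)
    (z : cycles G k ℓ) : homologyLift φ hφ (homologyClass z) = φ z := rfl

open Classical in
/-- The `A`-valued cochain on Eulerian `3`-paths which takes the value `c x y` on the paths
`(a, x, y, b)` with the fixed endpoints `a` and `b`, and vanishes on all other paths. -/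
noncomputable def edgeCochain (ℓ : ℕ) (a b : V) (c : V → V → A) : EMC G 3 ℓ →ₗ[ℤ] A :=
  Finsupp.lift A ℤ _ fun v => if v.1 0 = a ∧ v.1 3 = b then c (v.1 1) (v.1 2) else 0

theorem edgeCochain_tupleChain {a b x y : V} (c : V → V → A)
    (h : IsEulerianPath G ![a, x, y, b] ∧ len G ![a, x, y, b] = ℓ) :
    edgeCochain ℓ a b c (tupleChain G ℓ ![a, x, y, b]) = c x y := by
  rw [tupleChain_coe ⟨_, h⟩]
  simp [edgeCochain]

theorem edgeCochain_tupleChain_of_ne {a b : V} (c : V → V → A) {v : Fin 4 → V}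
    (hv : ¬(v 0 = a ∧ v 3 = b)) : edgeCochain ℓ a b c (tupleChain G ℓ v) = 0 := by
  by_cases h : IsEulerianPath G v ∧ len G v = ℓ
  · rw [tupleChain_coe ⟨v, h⟩]
    simp [edgeCochain, hv]
  · rw [tupleChain, dif_neg h, map_zero]

end Homology

section Graded

variable {P : Type*} [PartialOrder P] [GradeOrder ℕ P] {a b x y z : P} {k ℓ : ℕ}

theorem grade_le_grade_add_one_of_adj (h : (hasse P).Adj a b) :
    grade ℕ b ≤ grade ℕ a + 1 := by
  rcases hasse_adj.1 h with h | h <;> have := Nat.covBy_iff_add_one_eq.1 (h.grade ℕ) <;> omega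

theorem grade_le_grade_add_length (p : (hasse P).Walk a b) :
    grade ℕ b ≤ grade ℕ a + p.length := by
  induction p with
  | nil => exact le_rfl
  | cons h p ih =>
    have := grade_le_grade_add_one_of_adj h
    rw [Walk.length_cons]
    omega

theorem le_of_grade_add_length_eq (p : (hasse P).Walk a b)
    (hp : grade ℕ a + p.length = grade ℕ b) : a ≤ b := by
  induction p with
  | nil => exact le_rfl
  | cons h p ih =>
    have := grade_le_grade_add_length p
    rw [Walk.length_cons] at hp
    rcases hasse_adj.1 h with h | h <;> have := Nat.covBy_iff_add_one_eq.1 (h.grade ℕ)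
    · exact h.le.trans (ih (by omega))
    · omega

theorem exists_walk_grade_add_length_eq (h : a ≤ b) :
    ∃ p : (hasse P).Walk a b, grade ℕ a + p.length = grade ℕ b := by
  induction hn : grade ℕ b - grade ℕ a using Nat.strong_induction_on generalizing a with
  | _ n ih =>
    obtain rfl | hab := h.eq_or_lt
    · exact ⟨.nil, rfl⟩
    · obtain ⟨c, hac, hcb⟩ := exists_covBy_le_of_lt hab
      have hgrade := Nat.covBy_iff_add_one_eq.1 (hac.grade ℕ)
      have hlt := grade_strictMono (𝕆 := ℕ) hab
      obtain ⟨p, hp⟩ := ih _ (by omega) hcb rfl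
      refine ⟨.cons (hasse_adj.2 (.inl hac)) p, ?_⟩
      rw [Walk.length_cons]
      omega

theorem grade_le_grade_add_edist (a b : P) :
    (grade ℕ b : ℕ∞) ≤ grade ℕ a + (hasse P).edist a b := by
  by_cases h : (hasse P).edist a b = ⊤
  · simp [h]
  · obtain ⟨p, hp⟩ := exists_walk_of_edist_ne_top h
    rw [← hp]
    exact_mod_cast grade_le_grade_add_length p

theorem grade_add_edist_eq_iff :
    (grade ℕ a : ℕ∞) + (hasse P).edist a b = grade ℕ b ↔ a ≤ b := by
  refine ⟨fun h => ?_, fun h => ?_⟩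
  · have hne : (hasse P).edist a b ≠ ⊤ := fun htop => by simp [htop] at h
    obtain ⟨p, hp⟩ := exists_walk_of_edist_ne_top hne
    rw [← hp] at h
    exact le_of_grade_add_length_eq p (by exact_mod_cast h)
  · obtain ⟨p, hp⟩ := exists_walk_grade_add_length_eq h
    refine le_antisymm ?_ (grade_le_grade_add_edist a b)
    rw [← hp, Nat.cast_add]
    gcongr
    exact edist_le p

theorem grade_le_grade_add_len (v : Fin (k + 1) → P) :
    (grade ℕ (v (Fin.last k)) : ℕ∞) ≤ grade ℕ (v 0) + len (hasse P) v := by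
  induction k with
  | zero => simp
  | succ k ih =>
    rw [len_succ, ← add_assoc]
    exact (ih (Fin.tail v)).trans (add_le_add_left (grade_le_grade_add_edist _ _) _)

theorem grade_add_len_eq_iff {v : Fin (k + 1) → P} :
    (grade ℕ (v 0) : ℕ∞) + len (hasse P) v = grade ℕ (v (Fin.last k)) ↔ Monotone v := by
  induction k with
  | zero => simp [len, Subsingleton.monotone]
  | succ k ih =>
    have hcons : Monotone v ↔ v 0 ≤ v 1 ∧ Monotone (Fin.tail v) := by
      conv_lhs => rw [← Fin.cons_self_tail v]
      exact monotone_vecCons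
    rw [hcons, ← ih, ← grade_add_edist_eq_iff, len_succ, ← add_assoc]
    refine ⟨fun h => ?_, fun ⟨hfirst, htail⟩ => hfirst.symm ▸ htail⟩
    have hfinite : len (hasse P) (Fin.tail v) ≠ ⊤ := fun htop => by simp [htop] at h
    have hfirst := grade_le_grade_add_edist (v 0) (v 1)
    have htail := grade_le_grade_add_len (Fin.tail v)
    have hsum := le_antisymm (add_le_add_left hfirst _) (h.trans_le htail)
    exact ⟨((WithTop.add_right_inj hfinite).1 hsum).symm, hsum.trans h⟩

theorem isEulerianPath_and_len_eq_iff {v : Fin (k + 1) → P}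
    (h : grade ℕ (v 0) + ℓ = grade ℕ (v (Fin.last k))) :
    IsEulerianPath (hasse P) v ∧ len (hasse P) v = ℓ ↔ StrictMono v := by
  have hlen : len (hasse P) v = ℓ ↔ Monotone v := by
    rw [← grade_add_len_eq_iff, ← h, Nat.cast_add]
    exact (WithTop.add_left_inj (ENat.natCast_ne_top _)).symm
  rw [hlen]
  refine ⟨fun ⟨hpath, hmono⟩ => hmono.strictMono_of_injective hpath.2, fun hv =>
    ⟨⟨fun i => ⟨(hv i.castSucc_lt_succ).ne, lt_top_iff_ne_top.2 fun htop => ?_⟩, hv.injective⟩,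
      hv.monotone⟩⟩
  have hgrade := grade_add_edist_eq_iff.2 (hv.monotone i.castSucc_lt_succ.le)
  simp [htop] at hgrade

theorem boundary_tupleChain_four_of_strictMono (hℓ : grade ℕ a + ℓ = grade ℕ b)
    (h : StrictMono ![a, x, y, b]) :
    boundary (hasse P) 2 ℓ (tupleChain (hasse P) ℓ ![a, x, y, b]) =
      tupleChain (hasse P) ℓ ![a, x, b] - tupleChain (hasse P) ℓ ![a, y, b] :=
  boundary_tupleChain_four ((isEulerianPath_and_len_eq_iff hℓ).2 h)

theorem chainClass_tupleChain_add (hℓ : grade ℕ a + ℓ = grade ℕ b)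
    (h : StrictMono ![a, x, y, z, b]) :
    chainClass (tupleChain (hasse P) ℓ ![a, x, y, b]) +
        chainClass (tupleChain (hasse P) ℓ ![a, y, z, b]) =
      chainClass (tupleChain (hasse P) ℓ ![a, x, z, b]) := by
  have hboundary := chainClass_boundary (tupleChain (hasse P) ℓ ![a, x, y, z, b])
  rw [boundary_tupleChain_five ((isEulerianPath_and_len_eq_iff hℓ).2 h), map_sub, map_sub,
    sub_sub, sub_eq_zero] at hboundary
  exact hboundary.symm

theorem edgeCochain_comp_boundary {A : Type*} [AddCommGroup A] {c : P → P → A}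
    (hℓ : grade ℕ a + ℓ = grade ℕ b)
    (hc : ∀ x y z, StrictMono ![a, x, y, z, b] → c x y + c y z = c x z) :
    edgeCochain ℓ a b c ∘ₗ boundary (hasse P) 3 ℓ = 0 := by
  refine Finsupp.lhom_ext' fun ⟨v, hv⟩ => LinearMap.ext_ring ?_
  obtain ⟨p, x, y, z, q, rfl⟩ : ∃ p x y z q, v = ![p, x, y, z, q] :=
    ⟨_, _, _, _, _, (FinVec.etaExpand_eq v).symm⟩
  simp only [LinearMap.comp_apply, Finsupp.lsingle_apply, LinearMap.zero_apply,
    ← tupleChain_coe, boundary_tupleChain_five hv, map_sub]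
  by_cases hends : p = a ∧ q = b
  · obtain ⟨rfl, rfl⟩ := hends
    have hmono := (isEulerianPath_and_len_eq_iff hℓ).1 hv
    obtain ⟨hpx, hxy, hyz, hzq⟩ : p < x ∧ x < y ∧ y < z ∧ z < q := by simpa using hmono
    have hpath {u w : P} (h : StrictMono ![p, u, w, q]) :=
      edgeCochain_tupleChain c ((isEulerianPath_and_len_eq_iff hℓ).2 h)
    rw [hpath (by simp [hpx, hxy.trans hyz, hzq]), hpath (by simp [hpx, hxy, hyz.trans hzq]),
      hpath (by simp [hpx.trans hxy, hyz, hzq]), ← hc x y z hmono]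
    abel
  · simp [edgeCochain_tupleChain_of_ne c, hends]

end Graded

/-- The cells of the complex with vertices `0, 1, 2` in which every side of the triangle is replaced
by parallel edges labelled by `I`, and with a triangle for every solution of
`ι (s 2) + ι (s 0) = ι (s 1)` in `I`, together with a least and a greatest element.
As in a simplex, the edges `edge i s` are opposite to the vertex `i`. -/
inductive Cell {I A : Type*} [Zero I] [AddCommGroup A] (ι : ZeroHom I A)
  | bot | top
  | vertex (i : Fin 3)
  | edge (i : Fin 3) (s : I)
  | triangle (s : Fin 3 → I) (hs : ι (s 2) + ι (s 0) = ι (s 1))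

namespace Cell

variable {I A : Type*} [Zero I] [AddCommGroup A] {ι : ZeroHom I A}

instance [Finite I] : Finite (Cell ι) := by
  let f : Bool ⊕ Fin 3 ⊕ (Fin 3 × I) ⊕ {s : Fin 3 → I // ι (s 2) + ι (s 0) = ι (s 1)} → Cell ι :=
    Sum.elim (fun b => cond b top bot) <| Sum.elim vertex <|
      Sum.elim (fun q => edge q.1 q.2) fun s => triangle s.1 s.2
  refine Finite.of_surjective f ?_
  rintro (_ | _ | i | ⟨i, s⟩ | ⟨s, hs⟩)
  exacts [⟨.inl false, rfl⟩, ⟨.inl true, rfl⟩, ⟨.inr (.inl i), rfl⟩,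
    ⟨.inr (.inr (.inl (i, s))), rfl⟩, ⟨.inr (.inr (.inr ⟨s, hs⟩)), rfl⟩]

/-- The face relation between cells, which is the order of the face poset. -/
protected def LE : Cell ι → Cell ι → Prop
  | bot, _ | _, top => True
  | vertex i, vertex j => i = j
  | vertex i, edge j _ => i ≠ j
  | vertex _, triangle _ _ => True
  | edge i s, edge j t => i = j ∧ s = t
  | edge i s, triangle t _ => t i = s
  | triangle s _, triangle t _ => s = t
  | _, _ => False

instance : PartialOrder (Cell ι) where
  le := Cell.LE
  le_refl x := by cases x <;> simp [Cell.LE]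
  le_trans x y z := by cases x <;> cases y <;> cases z <;> simp +contextual [Cell.LE] <;> aesop
  le_antisymm x y := by cases x <;> cases y <;> simp +contextual [Cell.LE]

theorem lt_def {x y : Cell ι} : x < y ↔ Cell.LE x y ∧ ¬Cell.LE y x := Iff.rfl

/-- The rank function of the face poset: the dimension of a cell, shifted by one. -/
protected def rank : Cell ι → ℕ
  | bot => 0
  | vertex _ => 1
  | edge _ _ => 2
  | triangle _ _ => 3
  | top => 4

theorem rank_strictMono : StrictMono (Cell.rank : Cell ι → ℕ) := by
  intro x y
  cases x <;> cases y <;> simp +contextual [lt_def, Cell.LE, Cell.rank, eq_comm]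

theorem bot_lt_vertex (i : Fin 3) : bot < (vertex i : Cell ι) := by
  simp [lt_def, Cell.LE]

theorem vertex_lt_edge {i j : Fin 3} (h : j ≠ i) (s : I) : vertex j < (edge i s : Cell ι) := by
  simp [lt_def, Cell.LE, h]

theorem edge_lt_triangle (i : Fin 3) (t : Fin 3 → I) (ht : ι (t 2) + ι (t 0) = ι (t 1)) :
    edge i (t i) < triangle t ht := by
  simp [lt_def, Cell.LE]

theorem triangle_lt_top (t : Fin 3 → I) (ht : ι (t 2) + ι (t 0) = ι (t 1)) :
    triangle t ht < top := by
  simp [lt_def, Cell.LE]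

theorem edge_lt_top (i : Fin 3) (s : I) : edge i s < (top : Cell ι) := by
  simp [lt_def, Cell.LE]

theorem exists_edge_lt_triangle (i : Fin 3) (s : I) :
    ∃ (t : Fin 3 → I) (ht : ι (t 2) + ι (t 0) = ι (t 1)), edge i s < triangle t ht := by
  fin_cases i
  · exact ⟨![s, s, 0], by simp, edge_lt_triangle 0 _ _⟩
  · exact ⟨![s, s, 0], by simp, edge_lt_triangle 1 _ _⟩
  · exact ⟨![0, s, s], by simp, edge_lt_triangle 2 _ _⟩

theorem exists_between_of_rank_add_one_lt {x y : Cell ι} (h : x < y)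
    (hrank : x.rank + 1 < y.rank) : ∃ z, x < z ∧ z < y := by
  have hne (i : Fin 3) : i ≠ i + 1 := by decide +revert
  cases x <;> cases y <;> simp [Cell.rank] at hrank
  case bot.edge i s => exact ⟨vertex (i + 1), bot_lt_vertex _, vertex_lt_edge (hne i).symm s⟩
  case bot.triangle t ht =>
    exact ⟨vertex 0, bot_lt_vertex 0,
      (vertex_lt_edge (by decide) _).trans (edge_lt_triangle 1 t ht)⟩
  case bot.top =>
    exact ⟨vertex 0, bot_lt_vertex 0, (vertex_lt_edge (by decide) 0).trans (edge_lt_top 1 0)⟩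
  case vertex.triangle i t ht =>
    exact ⟨edge (i + 1) (t (i + 1)), vertex_lt_edge (hne i) _, edge_lt_triangle (i + 1) t ht⟩
  case vertex.top i => exact ⟨edge (i + 1) 0, vertex_lt_edge (hne i) 0, edge_lt_top (i + 1) 0⟩
  case edge.top i s =>
    obtain ⟨t, ht, h⟩ := exists_edge_lt_triangle (ι := ι) i s
    exact ⟨triangle t ht, h, triangle_lt_top t ht⟩

instance : GradeOrder ℕ (Cell ι) where
  grade := Cell.rank
  grade_strictMono := rank_strictMono
  covBy_grade {x y} h := by
    refine Nat.covBy_iff_add_one_eq.2 <|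
      le_antisymm (rank_strictMono h.lt) (not_lt.1 fun hrank => ?_)
    obtain ⟨z, hxz, hzy⟩ := exists_between_of_rank_add_one_lt h.lt hrank
    exact h.2 hxz hzy

theorem strictMono_bot_vertex_edge_top {i j : Fin 3} (h : j ≠ i) (s : I) :
    StrictMono ![bot, vertex j, edge i s, (top : Cell ι)] := by
  simp [bot_lt_vertex, vertex_lt_edge h, edge_lt_top]

theorem strictMono_bot_vertex_edge_triangle_top {i j : Fin 3} (h : j ≠ i) (t : Fin 3 → I)
    (ht : ι (t 2) + ι (t 0) = ι (t 1)) :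
    StrictMono ![bot, vertex j, edge i (t i), triangle t ht, top] := by
  simp [bot_lt_vertex, vertex_lt_edge h, edge_lt_triangle, triangle_lt_top]

/-- An `A`-valued `1`-cocycle on the order complex, with holonomy `ι s` around the loop formed by
`edge 2 s` and `edge 2 0`. Its value on `x < y` is the transport inside `y` from the first vertex of
`x` to the first vertex of `y`, where following `edge i s` from its second vertex to its first one
contributes `ι s`. -/
def label : Cell ι → Cell ι → A
  | vertex 1, edge 2 s | vertex 2, edge 1 s | vertex 2, edge 0 s => ι s
  | vertex 1, triangle t _ => ι (t 2)
  | vertex 2, triangle t _ => ι (t 1)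
  | edge 0 _, triangle t _ => ι (t 2)
  | _, _ => 0

theorem label_add {x y z : Cell ι} (h : StrictMono ![bot, x, y, z, top]) :
    label x y + label y z = label x z := by
  obtain ⟨hx, hxy, hyz, hz⟩ : bot < x ∧ x < y ∧ y < z ∧ z < top := by simpa using h
  have hrank := And.intro (rank_strictMono hx) <|
    And.intro (rank_strictMono hxy) <| And.intro (rank_strictMono hyz) (rank_strictMono hz)
  cases x <;> cases y <;> cases z <;> simp [Cell.rank] at hrank
  case vertex.edge.triangle i j s t ht =>
    obtain ⟨hij, rfl⟩ : i ≠ j ∧ t j = s := by simpa [lt_def, Cell.LE] using And.intro hxy hyz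
    fin_cases i <;> fin_cases j <;> first | exact absurd rfl hij | simp [label, ← ht, add_comm]

variable (ι) in
/-- The `1`-chain of the order complex which runs along `edge i s` from `vertex (i + 1)` to
`vertex (i + 2)`, indices being taken modulo `3`. -/
noncomputable def edgeArc (i : Fin 3) (s : I) : EMC (hasse (Cell ι)) 3 4 :=
  tupleChain _ 4 ![bot, vertex (i + 2), edge i s, top] -
    tupleChain _ 4 ![bot, vertex (i + 1), edge i s, top]

theorem boundary_edgeArc (i : Fin 3) (s : I) :
    boundary (hasse (Cell ι)) 2 4 (edgeArc ι i s) =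
      tupleChain _ 4 ![bot, vertex (i + 2), top] - tupleChain _ 4 ![bot, vertex (i + 1), top] := by
  have hne₁ : i + 1 ≠ i := by decide +revert
  have hne₂ : i + 2 ≠ i := by decide +revert
  rw [edgeArc, map_sub,
    boundary_tupleChain_four_of_strictMono rfl (strictMono_bot_vertex_edge_top hne₁ s),
    boundary_tupleChain_four_of_strictMono rfl (strictMono_bot_vertex_edge_top hne₂ s)]
  abel

theorem sum_chainClass_edgeArc {t : Fin 3 → I} (ht : ι (t 2) + ι (t 0) = ι (t 1)) :
    ∑ i, chainClass (edgeArc ι i (t i)) = 0 := by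
  let c (i : Fin 3) :=
    chainClass (tupleChain (hasse (Cell ι)) 4 ![bot, vertex i, triangle t ht, top])
  have hc (i : Fin 3) : chainClass (edgeArc ι i (t i)) = c (i + 2) - c (i + 1) := by
    have hne₁ : i + 1 ≠ i := by decide +revert
    have hne₂ : i + 2 ≠ i := by decide +revert
    have hadd (j : Fin 3) (hj : j ≠ i) := eq_sub_of_add_eq <| chainClass_tupleChain_add (ℓ := 4) rfl
      (strictMono_bot_vertex_edge_triangle_top hj t ht)
    rw [edgeArc, map_sub, hadd _ hne₁, hadd _ hne₂, sub_sub_sub_cancel_right]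
  have hshift (j : Fin 3) : ∑ i, c (i + j) = ∑ i, c i := Equiv.sum_comp (Equiv.addRight j) c
  simp only [hc, Finset.sum_sub_distrib, hshift, sub_self]

theorem edgeCochain_label_edgeArc (s : I) :
    edgeCochain 4 bot top label (edgeArc ι 2 s) = ι s := by
  have hpath (j : Fin 3) (hj : j ≠ 2) :=
    (isEulerianPath_and_len_eq_iff (ℓ := 4) rfl).2 (strictMono_bot_vertex_edge_top (ι := ι) hj s)
  rw [edgeArc, map_sub, edgeCochain_tupleChain _ (hpath _ (by decide)),
    edgeCochain_tupleChain _ (hpath _ (by decide))]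
  exact sub_zero (ι s)

variable (ι) in
/-- The class of the loop running along `edge 2 s` and back along `edge 2 0`. -/
noncomputable def loopClass (s : I) : EMH (hasse (Cell ι)) 3 4 :=
  homologyClass ⟨edgeArc ι 2 s - edgeArc ι 2 0, by
    rw [cycles, LinearMap.mem_ker, map_sub, boundary_edgeArc, boundary_edgeArc, sub_self]⟩

theorem loopClass_add {s t u : I} (h : ι s + ι t = ι u) :
    loopClass ι s + loopClass ι t = loopClass ι u := by
  have hsum (i j k : I) (h : ι i + ι j = ι k) :
      chainClass (edgeArc ι 2 i) + chainClass (edgeArc ι 0 j) + chainClass (edgeArc ι 1 k) = 0 := by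
    have := sum_chainClass_edgeArc (t := ![j, k, i]) h
    rw [Fin.sum_univ_three] at this
    rw [← this, Matrix.cons_val_zero, Matrix.cons_val_one, Matrix.cons_val_two]
    exact add_rotate _ _ _
  simp only [loopClass]
  rw [← map_add, homologyClass_eq_iff]
  simp only [Submodule.coe_add, map_add, map_sub]
  -- With these signs, the sides `edge 0` and `edge 1` of the four triangles cancel.
  linear_combination (norm := module) hsum s t u h - hsum 0 t t (by simp) + hsum t 0 t (by simp)
    - hsum u 0 u (by simp)

variable (ι) in
/-- The evaluation of homology classes on the cocycle `label`. -/
noncomputable def evalLabel : EMH (hasse (Cell ι)) 3 4 →ₗ[ℤ] A :=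
  homologyLift (edgeCochain 4 bot top label)
    (edgeCochain_comp_boundary rfl fun _ _ _ => label_add)

theorem evalLabel_loopClass (s : I) : evalLabel ι (loopClass ι s) = ι s := by
  simp only [evalLabel, loopClass, homologyLift_homologyClass, map_sub, edgeCochain_label_edgeArc,
    map_zero, sub_zero]

end Cell

open Cell in
theorem exists_injective_free_prod (n : ℕ) (T : Type) [AddCommGroup T] [Finite T] :
    ∃ (V : Type) (_ : Finite V) (G : SimpleGraph V) (f : (Fin n →₀ ℤ) × T →+ EMH G 3 4),
      Function.Injective f := by
  let _ : Zero (Fin n ⊕ T) := ⟨.inr 0⟩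
  let ι : ZeroHom (Fin n ⊕ T) ((Fin n →₀ ℤ) × T) :=
    ⟨Sum.elim (fun i => (Finsupp.single i 1, 0)) (fun t => (0, t)), rfl⟩
  have hinl (i : Fin n) : ι (.inl i) = (Finsupp.single i 1, 0) := rfl
  have hinr (t : T) : ι (.inr t) = (0, t) := rfl
  let f₁ : (Fin n →₀ ℤ) →+ EMH (hasse (Cell ι)) 3 4 :=
    (Finsupp.lift _ ℤ (Fin n) fun i => loopClass ι (.inl i)).toAddMonoidHom
  let f₂ : T →+ EMH (hasse (Cell ι)) 3 4 :=
    AddMonoidHom.mk' (fun t => loopClass ι (.inr t)) fun s t =>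
      (loopClass_add (by simp [hinr])).symm
  have hid (x : (Fin n →₀ ℤ) × T) : evalLabel ι (f₁.coprod f₂ x) = x := by
    ext <;> simp [f₁, f₂, evalLabel_loopClass, hinl, hinr, Prod.fst_sum, Prod.snd_sum]
  exact ⟨_, inferInstance, hasse (Cell ι), f₁.coprod f₂, Function.LeftInverse.injective hid⟩

end EulerianMagnitude

theorem theorem3 (A : Type*) [AddCommGroup A] [AddGroup.FG A] :
    ∃ (V : Type) (_ : Finite V) (G : SimpleGraph V) (k ℓ : ℕ), 0 < k ∧ 0 < ℓ ∧
      ∃ f : A →+ EulerianMagnitude.EMH G k ℓ, Function.Injective f := by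
  obtain ⟨n, ι, _, p, hp, e, ⟨φ⟩⟩ := AddCommGroup.equiv_free_prod_directSum_zmod A
  classical
  have : ∀ i, NeZero (p i ^ e i) := fun i => ⟨pow_ne_zero _ (hp i).ne_zero⟩
  have : Finite (DirectSum ι fun i => ZMod (p i ^ e i)) :=
    Finite.of_equiv _ (DirectSum.addEquivProd fun i => ZMod (p i ^ e i)).symm.toEquiv
  obtain ⟨V, hV, G, f, hf⟩ := EulerianMagnitude.exists_injective_free_prod n
    (DirectSum ι fun i => ZMod (p i ^ e i))
  exact ⟨V, hV, G, 3, 4, by norm_num, by norm_num, f.comp φ.toAddMonoidHom, hf.comp φ.injective⟩
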